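/- Let $\mathcal{S}=\mathcal{S}(\mathbb{R})$ be the space of complex-valued Schwartz functions on $\mathbb{R}$ and $\mathcal{S}'$ its dual, the space of tempered distributions. Put $N+1=\frac12\left(-\frac{d^2}{dx^2}+x^2+1\right)$ and, for $m\in\mathbb{N}_0$, $\|\varphi\|_m=\left(\int_{\mathbb{R}}|(N+1)^m\varphi(x)|^2\,dx\right)^{1/2}$. Let $\mathbf{s}'$ be the set of real sequences $(b_n)_{n\ge 0}$ with $|b_n|\le C(n+1)^k$ for all $n$, for some $C\in\mathbb{R}$, $k\in\mathbb{N}_0$, and let $\mathbf{s}$ be the set of real sequences $(a_n)_{n\ge 0}$ with $\sum_n (n+1)^{2k}|a_n|^2<\infty$ for every $k\in\mathbb{N}_0$. Define $$\mathcal{H}_{\mathbf{s}'}=\{(f_n)\in\mathcal{S}^{\mathbb{N}_0}: (\|f_n\|_m)_n\in\mathbf{s}'\text{ for all }m\},\qquad \mathcal{H}_{\mathbf{s}}=\{(f_n)\in\mathcal{S}^{\mathbb{N}_0}: (\|f_n\|_m)_n\in\mathbf{s}\text{ for all }m\},$$ $\mathcal{H}=\mathcal{H}_{\mathbf{s}'}/\mathcal{H}_{\mathbf{s}}$,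 and write $[f_n]\in\mathcal H$ for the class of $(f_n)\in\mathcal{H}_{\mathbf{s}'}$. Derivatives and multiplication by $x$ act on $\mathcal{H}$ termwise: $D[f_n]=[f_n']$, $x[f_n]=[xf_n]$. Let $$h_n(x)=\left(\sqrt{\pi}\,n!\right)^{-1/2}e^{-x^2/2}\,\mathrm{He}_n(\sqrt2\,x),\qquad \mathrm{He}_n(y)=(-1)^n e^{y^2/2}\frac{d^n}{dy^n}e^{-y^2/2},$$ be the Hermite functions (so that $(N+1)h_n=(n+1)h_n$), and let $\iota:\mathcal{S}'\to\mathcal{H}$ be the linear map $\iota(T)=[T_n]$ with $T_n=\sum_{j=0}^n T(h_j)h_j$. Let $\mathcal{F}$ be the Fourier transform $\mathcal{F}\varphi(t)=\frac1{\sqrt{2\pi}}\int_{\mathbb{R}}e^{-itx}\varphi(x)\,dx$ on $\mathcal{S}$, and set $(\mathcal{F}T)(\varphi)=T(\mathcal{F}\varphi)$ for $T\in\mathcal{S}'$, $\varphi\in\mathcal S$. **Theorem.** (a) The formula $\mathcal{F}[f_n]=[\mathcal{F}f_n]$ gives a well-defined $\mathbb{C}$-linear isomorphism $\mathcal{F}:\mathcal{H}\to\mathcal{H}$,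 with inverse $\mathcal{F}^{-1}[f_n]=[\mathcal{F}^{-1}f_n]$. (b) For all $u\in\mathcal{H}$ and $\alpha\in\mathbb{N}_0$, $\mathcal{F}(D^\alpha u)=(ix)^\alpha\,\mathcal{F}u$ and $\mathcal{F}(x^\alpha u)=i^\alpha D^\alpha\,\mathcal{F}u$. (c) For every $T\in\mathcal{S}'$, $\iota(\mathcal{F}T)=\mathcal{F}(\iota T)$. -/

import Mathlib

open scoped SchwartzMap FourierTransform

noncomputable section

namespace TemperedGF

/-- The derivative `D` on the Schwartz space. -/
def schwartzD : 𝓢(ℝ, ℂ) →L[ℂ] 𝓢(ℝ, ℂ) := SchwartzMap.derivCLM ℂ ℂ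

/-- Multiplication by the variable, `φ ↦ x φ`, on the Schwartz space. -/
def schwartzX : 𝓢(ℝ, ℂ) →L[ℂ] 𝓢(ℝ, ℂ) := SchwartzMap.smulLeftCLM ℂ (fun x : ℝ => (x : ℂ))

theorem schwartzD_apply (φ : 𝓢(ℝ, ℂ)) (x : ℝ) : schwartzD φ x = deriv φ x := rfl

theorem schwartzX_apply (φ : 𝓢(ℝ, ℂ)) (x : ℝ) : schwartzX φ x = (x : ℂ) * φ x := by
  have h : (fun x : ℝ => (x : ℂ)).HasTemperateGrowth := by fun_prop
  simp [schwartzX, SchwartzMap.smulLeftCLM_apply_apply h]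

/-- The operator `N + 1 = (1/2) (-d²/dx² + x² + 1)`. -/
def numberOp : 𝓢(ℝ, ℂ) →L[ℂ] 𝓢(ℝ, ℂ) :=
  (1 / 2 : ℂ) • (-(schwartzD ∘L schwartzD) + schwartzX ∘L schwartzX +
    ContinuousLinearMap.id ℂ 𝓢(ℝ, ℂ))

/-- The norm `‖φ‖_m = (∫ |(N+1)^m φ(x)|² dx)^{1/2}`. -/
def hNorm (m : ℕ) (φ : 𝓢(ℝ, ℂ)) : ℝ :=
  Real.sqrt (∫ x : ℝ, ‖((numberOp ^ m) φ) x‖ ^ 2)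

theorem numberOp_eq (φ : 𝓢(ℝ, ℂ)) : numberOp φ =
    (1 / 2 : ℂ) • (-schwartzD (schwartzD φ) + schwartzX (schwartzX φ) + φ) := rfl

theorem hNorm_eq (m : ℕ) (φ : 𝓢(ℝ, ℂ)) :
    hNorm m φ = ‖SchwartzMap.toLpCLM ℂ ℂ 2 MeasureTheory.volume ((numberOp ^ m) φ)‖ := by
  rw [SchwartzMap.toLpCLM_apply, SchwartzMap.norm_toLp' (by simp) (by simp), hNorm,
    Real.sqrt_eq_rpow]
  norm_num

theorem hNorm_nonneg (m : ℕ) (φ : 𝓢(ℝ, ℂ)) : 0 ≤ hNorm m φ := Real.sqrt_nonneg _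

theorem hNorm_zero (m : ℕ) : hNorm m 0 = 0 := by simp [hNorm_eq, -SchwartzMap.toLpCLM_apply]

theorem hNorm_add_le (m : ℕ) (φ ψ : 𝓢(ℝ, ℂ)) : hNorm m (φ + ψ) ≤ hNorm m φ + hNorm m ψ := by
  simp only [hNorm_eq, map_add]; exact norm_add_le _ _

theorem hNorm_smul (m : ℕ) (c : ℂ) (φ : 𝓢(ℝ, ℂ)) : hNorm m (c • φ) = ‖c‖ * hNorm m φ := by
  simp only [hNorm_eq, map_smul]; exact norm_smul _ _

theorem hNorm_neg (m : ℕ) (φ : 𝓢(ℝ, ℂ)) : hNorm m (-φ) = hNorm m φ := by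
  simp only [hNorm_eq, map_neg]; exact norm_neg _

theorem hNorm_sub_le (m : ℕ) (φ ψ : 𝓢(ℝ, ℂ)) : hNorm m (φ - ψ) ≤ hNorm m φ + hNorm m ψ := by
  rw [sub_eq_add_neg, ← hNorm_neg m ψ]; exact hNorm_add_le _ _ _

theorem hNorm_numberOp (m : ℕ) (φ : 𝓢(ℝ, ℂ)) : hNorm m (numberOp φ) = hNorm (m + 1) φ := by
  simp only [hNorm, pow_succ]; rfl

/-- The real part of the `L²` scalar product. -/
def ip (φ ψ : 𝓢(ℝ, ℂ)) : ℝ :=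
  (inner ℂ (SchwartzMap.toLpCLM ℂ ℂ 2 MeasureTheory.volume φ)
    (SchwartzMap.toLpCLM ℂ ℂ 2 MeasureTheory.volume ψ) : ℂ).re

theorem ip_eq (φ ψ : 𝓢(ℝ, ℂ)) : ip φ ψ = (∫ x, (starRingEnd ℂ) (φ x) * ψ x).re := by
  simp only [ip, SchwartzMap.toLpCLM_apply, SchwartzMap.inner_toL2_toL2_eq, RCLike.inner_apply]
  simp only [mul_comm]

theorem ip_self (φ : 𝓢(ℝ, ℂ)) : ip φ φ = hNorm 0 φ ^ 2 := by
  rw [hNorm_eq, ip, pow_zero]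
  exact (norm_sq_eq_re_inner (𝕜 := ℂ) _).symm

theorem ip_le (φ ψ : 𝓢(ℝ, ℂ)) : ip φ ψ ≤ hNorm 0 φ * hNorm 0 ψ := by
  simp only [hNorm_eq]; exact re_inner_le_norm (𝕜 := ℂ) _ _

theorem ip_D (φ ψ : 𝓢(ℝ, ℂ)) : ip φ (schwartzD ψ) = -ip (schwartzD φ) ψ := by
  rw [ip_eq, ip_eq, ← Complex.neg_re]
  congr 1
  exact SchwartzMap.integral_bilinear_deriv_right_eq_neg_left φ ψ
    ((ContinuousLinearMap.mul ℝ ℂ).comp (Complex.conjCLE : ℂ →L[ℝ] ℂ))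

theorem ip_X (φ ψ : 𝓢(ℝ, ℂ)) : ip φ (schwartzX ψ) = ip (schwartzX φ) ψ := by
  rw [ip_eq, ip_eq]
  congr 2
  ext x
  simp [schwartzX_apply]; ring

theorem ip_add_right (φ ψ χ : 𝓢(ℝ, ℂ)) : ip φ (ψ + χ) = ip φ ψ + ip φ χ := by
  simp only [ip, map_add, inner_add_right, Complex.add_re]

theorem ip_neg_right (φ ψ : 𝓢(ℝ, ℂ)) : ip φ (-ψ) = -ip φ ψ := by
  simp only [ip, map_neg, inner_neg_right, Complex.neg_re]

theorem two_ip_numberOp (φ : 𝓢(ℝ, ℂ)) : 2 * ip φ (numberOp φ) =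
    hNorm 0 (schwartzD φ) ^ 2 + hNorm 0 (schwartzX φ) ^ 2 + hNorm 0 φ ^ 2 := by
  have h : 2 * ip φ (numberOp φ) = ip φ ((2 : ℂ) • numberOp φ) := by
    simp only [ip, map_smul, inner_smul_right]; simp
  rw [h, numberOp_eq, smul_smul]
  norm_num
  rw [ip_add_right, ip_add_right, ip_neg_right, ip_D, ip_X, ip_self, ip_self, ip_self]
  ring

theorem base_bound (φ : 𝓢(ℝ, ℂ)) : hNorm 0 (schwartzD φ) ≤ hNorm 1 φ ∧
    hNorm 0 (schwartzX φ) ≤ hNorm 1 φ ∧ hNorm 0 φ ≤ 2 * hNorm 1 φ := by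
  have h1 := two_ip_numberOp φ
  have h2 := ip_le φ (numberOp φ)
  rw [hNorm_numberOp] at h2
  have h3 := hNorm_nonneg 1 φ
  have h4 := hNorm_nonneg 0 φ
  refine ⟨abs_le_of_sq_le_sq' ?_ h3 |>.2, abs_le_of_sq_le_sq' ?_ h3 |>.2,
    abs_le_of_sq_le_sq' ?_ (by positivity) |>.2⟩
  all_goals norm_num at h2 ⊢
  all_goals nlinarith [sq_nonneg (hNorm 0 (schwartzD φ)), sq_nonneg (hNorm 0 (schwartzX φ)),
      sq_nonneg (hNorm 0 φ - hNorm 1 φ), sq_nonneg (hNorm 0 φ - 2 * hNorm 1 φ)]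

theorem hNorm_le_succ (m : ℕ) (φ : 𝓢(ℝ, ℂ)) : hNorm m φ ≤ 2 * hNorm (m + 1) φ := by
  induction m generalizing φ with
  | zero => exact (base_bound φ).2.2
  | succ m ih => simpa only [hNorm_numberOp] using ih (numberOp φ)

theorem D_X (φ : 𝓢(ℝ, ℂ)) : schwartzD (schwartzX φ) = schwartzX (schwartzD φ) + φ := by
  ext x
  have h : (schwartzX φ : ℝ → ℂ) = fun x : ℝ => (x : ℂ) * φ x := funext (schwartzX_apply φ)
  have h2 : HasDerivAt (fun x : ℝ => (x : ℂ) * φ x) (1 * φ x + (x : ℂ) * deriv φ x) x :=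
    (Complex.ofRealCLM.hasDerivAt (x := x)).mul (φ.hasDerivAt x)
  rw [schwartzD_apply, h, h2.deriv]
  simp [schwartzX_apply, schwartzD_apply]; ring

theorem numberOp_X (φ : 𝓢(ℝ, ℂ)) :
    numberOp (schwartzX φ) = schwartzX (numberOp φ) - schwartzD φ := by
  simp only [numberOp_eq, D_X, map_add, map_smul, map_neg]
  module

theorem numberOp_D (φ : 𝓢(ℝ, ℂ)) :
    numberOp (schwartzD φ) = schwartzD (numberOp φ) - schwartzX φ := by
  simp only [numberOp_eq, D_X, map_add, map_smul, map_neg]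
  module

theorem hNorm_D_X_le (m : ℕ) (φ : 𝓢(ℝ, ℂ)) :
    hNorm m (schwartzD φ) ≤ 3 ^ m * hNorm (m + 1) φ ∧
    hNorm m (schwartzX φ) ≤ 3 ^ m * hNorm (m + 1) φ := by
  induction m generalizing φ with
  | zero => simpa using ⟨(base_bound φ).1, (base_bound φ).2.1⟩
  | succ m ih =>
    have h1 := ih φ
    have h2 := ih (numberOp φ)
    have h3 := hNorm_le_succ (m + 1) φ
    rw [hNorm_numberOp] at h2
    have h4 : (0 : ℝ) < 3 ^ m := by positivity
    have h5 : (3 : ℝ) ^ m * hNorm (m + 1) φ ≤ 3 ^ m * (2 * hNorm (m + 1 + 1) φ) := by gcongr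
    rw [← hNorm_numberOp m (schwartzD φ), ← hNorm_numberOp m (schwartzX φ), numberOp_D,
      numberOp_X, pow_succ]
    constructor
    · refine (hNorm_sub_le _ _ _).trans ?_
      linarith [h2.1, h1.2]
    · refine (hNorm_sub_le _ _ _).trans ?_
      linarith [h2.2, h1.1]

theorem hNorm_sup_le (φ : 𝓢(ℝ, ℂ)) (x : ℝ) : ‖φ x‖ ≤ 3 * hNorm 1 φ := by
  have hd (y : ℝ) : HasDerivAt (fun y => ‖φ y‖ ^ 2) (2 * inner ℝ (φ y) (deriv φ y)) y :=
    (φ.hasDerivAt y).norm_sq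
  have hint (ψ : 𝓢(ℝ, ℂ)) : MeasureTheory.Integrable (fun y => ‖ψ y‖ ^ 2) := by
    simpa using (ψ.memLp 2 MeasureTheory.volume).integrable_norm_pow (by norm_num)
  have hb (y : ℝ) : ‖2 * inner ℝ (φ y) (deriv φ y)‖ ≤ ‖φ y‖ ^ 2 + ‖schwartzD φ y‖ ^ 2 := by
    have := abs_real_inner_le_norm (φ y) (deriv φ y)
    rw [norm_mul, Real.norm_eq_abs, Real.norm_eq_abs, abs_two, schwartzD_apply]
    nlinarith [sq_nonneg (‖φ y‖ - ‖deriv φ y‖)]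
  have hI := (hint φ).add (hint (schwartzD φ))
  have hc : Continuous fun y => 2 * inner ℝ (φ y) (deriv φ y) :=
    continuous_const.mul (φ.continuous.inner (schwartzD φ).continuous)
  have hInt : MeasureTheory.Integrable (fun y => 2 * inner ℝ (φ y) (deriv φ y)) :=
    hI.mono' hc.aestronglyMeasurable (Filter.Eventually.of_forall hb)
  have ht : Filter.Tendsto (fun y => ‖φ y‖ ^ 2) Filter.atBot (nhds 0) := by
    have := ((φ.tendsto_cocompact).mono_left atBot_le_cocompact).norm.pow 2
    simpa using this
  have h := MeasureTheory.integral_Iic_of_hasDerivAt_of_tendsto' (a := x) (fun y _ => hd y)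
    hInt.integrableOn ht
  have h1 : ‖φ x‖ ^ 2 ≤ hNorm 0 φ ^ 2 + hNorm 0 (schwartzD φ) ^ 2 := by
    rw [sub_zero] at h
    rw [← h]
    refine (Real.le_norm_self _).trans ((MeasureTheory.norm_integral_le_integral_norm _).trans ?_)
    refine (MeasureTheory.setIntegral_le_integral hInt.norm
      (Filter.Eventually.of_forall fun y => norm_nonneg _)).trans ?_
    refine (MeasureTheory.integral_mono hInt.norm hI hb).trans (le_of_eq ?_)
    simp only [Pi.add_apply]
    rw [MeasureTheory.integral_add (hint φ) (hint _), hNorm, hNorm, Real.sq_sqrt, Real.sq_sqrt]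
    · rfl
    all_goals positivity
  have h2 := base_bound φ
  have h3 := hNorm_nonneg 0 φ
  have h4 := hNorm_nonneg 0 (schwartzD φ)
  have h5 := hNorm_nonneg 1 φ
  refine abs_le_of_sq_le_sq' ?_ (by positivity) |>.2
  nlinarith [mul_nonneg h3 h5, mul_nonneg h4 h5, h2.1, h2.2.2]

theorem schwartzD_pow_apply (l : ℕ) (φ : 𝓢(ℝ, ℂ)) :
    ((schwartzD ^ l) φ : ℝ → ℂ) = iteratedDeriv l φ := by
  induction l with
  | zero => simp
  | succ l ih =>
    rw [iteratedDeriv_succ, ← ih, pow_succ']; rfl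

theorem schwartzX_pow_apply (k : ℕ) (φ : 𝓢(ℝ, ℂ)) (x : ℝ) :
    (schwartzX ^ k) φ x = (x : ℂ) ^ k * φ x := by
  induction k with
  | zero => simp
  | succ l ih =>
    rw [pow_succ']
    change schwartzX ((schwartzX ^ l) φ) x = _
    rw [schwartzX_apply, ih]; ring

/-- Polynomial growth in the scale of norms. -/
theorem pow_le (A : 𝓢(ℝ, ℂ) →L[ℂ] 𝓢(ℝ, ℂ))
    (hA : ∀ m, ∃ C : ℝ, ∃ M : ℕ, 0 ≤ C ∧ ∀ φ, hNorm m (A φ) ≤ C * hNorm M φ) (k m : ℕ) :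
    ∃ C : ℝ, ∃ M : ℕ, 0 ≤ C ∧ ∀ φ, hNorm m ((A ^ k) φ) ≤ C * hNorm M φ := by
  induction k generalizing m with
  | zero => exact ⟨1, m, zero_le_one, fun φ => by simp⟩
  | succ k ih =>
    obtain ⟨C, M, hC, h⟩ := hA m
    obtain ⟨C', M', hC', h'⟩ := ih M
    refine ⟨C * C', M', by positivity, fun φ => ?_⟩
    rw [pow_succ', mul_assoc]
    change hNorm m (A ((A ^ k) φ)) ≤ _
    exact (h _).trans (by gcongr; exact h' φ)

theorem schwartzD_bound (m : ℕ) :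
    ∃ C : ℝ, ∃ M : ℕ, 0 ≤ C ∧ ∀ φ, hNorm m (schwartzD φ) ≤ C * hNorm M φ :=
  ⟨3 ^ m, m + 1, by positivity, fun φ => (hNorm_D_X_le m φ).1⟩

theorem schwartzX_bound (m : ℕ) :
    ∃ C : ℝ, ∃ M : ℕ, 0 ≤ C ∧ ∀ φ, hNorm m (schwartzX φ) ≤ C * hNorm M φ :=
  ⟨3 ^ m, m + 1, by positivity, fun φ => (hNorm_D_X_le m φ).2⟩

theorem seminorm_bound (k l : ℕ) :
    ∃ C : ℝ, ∃ M : ℕ, 0 ≤ C ∧ ∀ φ : 𝓢(ℝ, ℂ), SchwartzMap.seminorm ℂ k l φ ≤ C * hNorm M φ := by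
  obtain ⟨C, M, hC, h⟩ := pow_le _ schwartzX_bound k 1
  obtain ⟨C', M', hC', h'⟩ := pow_le _ schwartzD_bound l M
  refine ⟨3 * (C * C'), M', by positivity, fun φ => ?_⟩
  refine SchwartzMap.seminorm_le_bound' ℂ k l φ (by have := hNorm_nonneg M' φ; positivity) fun x => ?_
  have := hNorm_sup_le ((schwartzX ^ k) ((schwartzD ^ l) φ)) x
  rw [schwartzX_pow_apply, schwartzD_pow_apply, norm_mul, norm_pow, Complex.norm_real,
    Real.norm_eq_abs] at this
  refine this.trans ?_
  rw [mul_assoc, mul_assoc]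
  gcongr
  exact (h _).trans (by gcongr; exact h' φ)

theorem hNorm_mono {m M : ℕ} (h : m ≤ M) (φ : 𝓢(ℝ, ℂ)) : hNorm m φ ≤ 2 ^ (M - m) * hNorm M φ := by
  induction M, h using Nat.le_induction with
  | base => simp
  | succ M hm ih =>
    refine ih.trans ?_
    rw [Nat.succ_sub hm, pow_succ, mul_assoc]
    gcongr
    exact hNorm_le_succ M φ

theorem tempered_bound (T : 𝓢'(ℝ, ℂ)) :
    ∃ C : ℝ, ∃ M : ℕ, 0 ≤ C ∧ ∀ φ : 𝓢(ℝ, ℂ), ‖T φ‖ ≤ C * hNorm M φ := by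
  have hT : Continuous fun φ : 𝓢(ℝ, ℂ) => T φ := T.continuous
  let q : Seminorm ℂ 𝓢(ℝ, ℂ) := (normSeminorm ℂ ℂ).comp (T : 𝓢(ℝ, ℂ) →ₗ[ℂ] ℂ)
  have hq : Continuous q := hT.norm
  obtain ⟨s, C, -, h⟩ := Seminorm.bound_of_continuous (schwartz_withSeminorms ℂ ℝ ℂ) q hq
  have hs : ∃ C : ℝ, ∃ M : ℕ, 0 ≤ C ∧ ∀ φ : 𝓢(ℝ, ℂ),
      (s.sup (schwartzSeminormFamily ℂ ℝ ℂ)) φ ≤ C * hNorm M φ := by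
    clear h
    induction s using Finset.induction_on with
    | empty => exact ⟨0, 0, le_rfl, fun φ => by simp⟩
    | insert a s ha ih =>
      obtain ⟨C₁, M₁, hC₁, h₁⟩ := ih
      obtain ⟨C₂, M₂, hC₂, h₂⟩ := seminorm_bound a.1 a.2
      refine ⟨C₁ * 2 ^ (M₁ + M₂ - M₁) + C₂ * 2 ^ (M₁ + M₂ - M₂), M₁ + M₂, by positivity,
        fun φ => ?_⟩
      have e₁ := hNorm_mono (Nat.le_add_right M₁ M₂) φ
      have e₂ := hNorm_mono (Nat.le_add_left M₂ M₁) φ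
      have := hNorm_nonneg (M₁ + M₂) φ
      rw [Finset.sup_insert, add_mul, mul_assoc, mul_assoc]
      refine max_le (a := schwartzSeminormFamily ℂ ℝ ℂ a φ) ?_ ?_
      · refine (h₂ φ).trans ?_
        have : C₂ * hNorm M₂ φ ≤ C₂ * (2 ^ (M₁ + M₂ - M₂) * hNorm (M₁ + M₂) φ) := by gcongr
        have : 0 ≤ C₁ * (2 ^ (M₁ + M₂ - M₁) * hNorm (M₁ + M₂) φ) := by positivity
        linarith
      · refine (h₁ φ).trans ?_
        have : C₁ * hNorm M₁ φ ≤ C₁ * (2 ^ (M₁ + M₂ - M₁) * hNorm (M₁ + M₂) φ) := by gcongr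
        have : 0 ≤ C₂ * (2 ^ (M₁ + M₂ - M₂) * hNorm (M₁ + M₂) φ) := by positivity
        linarith
  obtain ⟨C', M, hC', h'⟩ := hs
  refine ⟨C * C', M, by positivity, fun φ => (h φ).trans ?_⟩
  rw [mul_assoc]
  exact mul_le_mul_of_nonneg_left (h' φ) C.2

/-! ### Hermite functions -/

theorem hasDerivAt_polyGaussian (p : Polynomial ℝ) (x : ℝ) :
    HasDerivAt (fun x : ℝ => ((p.eval x * Real.exp (-x ^ 2 / 2) : ℝ) : ℂ))
      (((Polynomial.derivative p - Polynomial.X * p).eval x * Real.exp (-x ^ 2 / 2) : ℝ) : ℂ) x := by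
  have h1 : HasDerivAt (fun x : ℝ => Real.exp (-x ^ 2 / 2)) (Real.exp (-x ^ 2 / 2) * -x) x := by
    have h2 : HasDerivAt (fun x : ℝ => -x ^ 2 / 2) (-x) x := by
      exact ((hasDerivAt_pow 2 x).neg.div_const 2).congr_deriv (by norm_num; ring)
    exact h2.exp
  have h := ((p.hasDerivAt x).mul h1).ofReal_comp
  refine h.congr_deriv ?_
  rw [Polynomial.eval_sub, Polynomial.eval_mul, Polynomial.eval_X]
  congr 1
  ring

theorem polyGaussian_bdd (p : Polynomial ℝ) :
    ∃ C : ℝ, ∀ x : ℝ, ‖((p.eval x * Real.exp (-x ^ 2 / 2) : ℝ) : ℂ)‖ ≤ C := by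
  induction p using Polynomial.induction_on' with
  | add p q hp hq =>
    obtain ⟨C, hC⟩ := hp
    obtain ⟨C', hC'⟩ := hq
    refine ⟨C + C', fun x => ?_⟩
    rw [Polynomial.eval_add, add_mul, Complex.ofReal_add]
    exact (norm_add_le _ _).trans (add_le_add (hC x) (hC' x))
  | monomial n a =>
    refine ⟨|a| * (n.factorial * Real.exp (1 / 2)), fun x => ?_⟩
    rw [Polynomial.eval_monomial, Complex.norm_real, norm_mul, norm_mul, mul_assoc,
      Real.norm_eq_abs]
    refine mul_le_mul_of_nonneg_left ?_ (abs_nonneg a)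
    have h1 := Real.pow_div_factorial_le_exp |x| (abs_nonneg x) n
    have h2 : Real.exp |x| * Real.exp (-x ^ 2 / 2) ≤ Real.exp (1 / 2) := by
      rw [← Real.exp_add]
      apply Real.exp_le_exp.2
      nlinarith [sq_nonneg (|x| - 1), sq_abs x]
    rw [div_le_iff₀ (by positivity)] at h1
    rw [norm_pow, Real.norm_eq_abs, Real.norm_eq_abs, Real.abs_exp]
    calc |x| ^ n * Real.exp (-x ^ 2 / 2)
        ≤ (Real.exp |x| * n.factorial) * Real.exp (-x ^ 2 / 2) := by gcongr
      _ = n.factorial * (Real.exp |x| * Real.exp (-x ^ 2 / 2)) := by ring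
      _ ≤ _ := by gcongr

theorem iteratedDeriv_polyGaussian (n : ℕ) (p : Polynomial ℝ) : ∃ q : Polynomial ℝ,
    iteratedDeriv n (fun x : ℝ => ((p.eval x * Real.exp (-x ^ 2 / 2) : ℝ) : ℂ)) =
      fun x : ℝ => ((q.eval x * Real.exp (-x ^ 2 / 2) : ℝ) : ℂ) := by
  induction n with
  | zero => exact ⟨p, by simp⟩
  | succ n ih =>
    obtain ⟨q, hq⟩ := ih
    exact ⟨_, by rw [iteratedDeriv_succ, hq]; exact funext fun x => (hasDerivAt_polyGaussian q x).deriv⟩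

/-- The Schwartz function `p(x) e^{-x²/2}`, for a polynomial `p`. -/
def polyGaussian (p : Polynomial ℝ) : 𝓢(ℝ, ℂ) where
  toFun x := ((p.eval x * Real.exp (-x ^ 2 / 2) : ℝ) : ℂ)
  smooth' := by
    have h : ContDiff ℝ (⊤ : ℕ∞) fun x : ℝ => p.eval x * Real.exp (-x ^ 2 / 2) :=
      (by simpa using p.contDiff_aeval (𝕜 := ℝ) _ : ContDiff ℝ _ fun x => p.eval x).mul (by fun_prop)
    exact Complex.ofRealCLM.contDiff.comp h
  decay' k n := by
    obtain ⟨q, hq⟩ := iteratedDeriv_polyGaussian n p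
    obtain ⟨C, hC⟩ := polyGaussian_bdd (Polynomial.X ^ k * q)
    refine ⟨C, fun x => ?_⟩
    rw [norm_iteratedFDeriv_eq_norm_iteratedDeriv, hq]
    have := hC x
    rw [Polynomial.eval_mul, Polynomial.eval_pow, Polynomial.eval_X, mul_assoc,
      Complex.ofReal_mul, norm_mul, Complex.norm_real, norm_pow] at this
    exact this

theorem polyGaussian_apply (p : Polynomial ℝ) (x : ℝ) :
    polyGaussian p x = ((p.eval x * Real.exp (-x ^ 2 / 2) : ℝ) : ℂ) := rfl

/-- The polynomial factor `He_n(√2 x)` of the Hermite function. -/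
def hermitePoly (n : ℕ) : Polynomial ℝ :=
  ((Polynomial.hermite n).map (Int.castRingHom ℝ)).comp
      (Polynomial.C (Real.sqrt 2) * Polynomial.X)

/-- The `n`-th Hermite function `h_n(x) = (√π n!)^{-1/2} e^{-x²/2} He_n(√2 x)`, where
`He_n(y) = (-1)^n e^{y²/2} (d/dy)^n e^{-y²/2}`. -/
def hermiteFun (n : ℕ) : 𝓢(ℝ, ℂ) :=
  (((Real.sqrt (Real.sqrt Real.pi * n.factorial))⁻¹ : ℝ) : ℂ) •
    polyGaussian (hermitePoly n)

theorem hermiteFun_apply (n : ℕ) (x : ℝ) : hermiteFun n x =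
    (((Real.sqrt (Real.sqrt Real.pi * n.factorial))⁻¹ * Real.exp (-x ^ 2 / 2) *
      Polynomial.aeval (Real.sqrt 2 * x) (Polynomial.hermite n) : ℝ) : ℂ) := by
  simp [hermiteFun, hermitePoly, polyGaussian_apply, Polynomial.aeval_def, Polynomial.eval_map]
  ring

theorem polyGaussian_D (p : Polynomial ℝ) : schwartzD (polyGaussian p) =
    polyGaussian (Polynomial.derivative p - Polynomial.X * p) := by
  ext x; exact (hasDerivAt_polyGaussian p x).deriv

theorem polyGaussian_X (p : Polynomial ℝ) : schwartzX (polyGaussian p) =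
    polyGaussian (Polynomial.X * p) := by
  ext x; simp [schwartzX_apply, polyGaussian_apply, mul_assoc]

theorem polyGaussian_smul (c : ℝ) (p : Polynomial ℝ) :
    polyGaussian (Polynomial.C c * p) = (c : ℂ) • polyGaussian p := by
  ext x; simp [polyGaussian_apply, mul_assoc]

theorem polyGaussian_add (p q : Polynomial ℝ) :
    polyGaussian (p + q) = polyGaussian p + polyGaussian q := by
  ext x; simp [polyGaussian_apply, add_mul]

theorem polyGaussian_neg (p : Polynomial ℝ) : polyGaussian (-p) = -polyGaussian p := by
  ext x; simp [polyGaussian_apply]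

theorem derivative_hermite_succ (n : ℕ) : Polynomial.derivative (Polynomial.hermite (n + 1)) =
    ((n : Polynomial ℤ) + 1) * Polynomial.hermite n := by
  induction n with
  | zero => simp [Polynomial.hermite_succ]
  | succ n ih =>
    have h := Polynomial.hermite_succ n
    rw [Polynomial.hermite_succ (n + 1), map_sub, Polynomial.derivative_mul, ih,
      Polynomial.derivative_mul]
    simp only [Polynomial.derivative_X, map_add, Polynomial.derivative_natCast,
      Polynomial.derivative_one]
    push_cast
    linear_combination -((n : Polynomial ℤ) + 1) * h

theorem hermitePoly_succ (n : ℕ) : Polynomial.C (Real.sqrt 2) * hermitePoly (n + 1) =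
    Polynomial.C 2 * Polynomial.X * hermitePoly n - Polynomial.derivative (hermitePoly n) := by
  have h2 : (Polynomial.C (Real.sqrt 2)) ^ 2 = Polynomial.C 2 := by
    rw [← map_pow, Real.sq_sqrt (by norm_num)]
  rw [← h2]
  simp only [hermitePoly, Polynomial.hermite_succ, Polynomial.derivative_comp,
    Polynomial.derivative_map, Polynomial.map_sub, Polynomial.map_mul, Polynomial.map_X,
    Polynomial.sub_comp, Polynomial.mul_comp, Polynomial.X_comp, Polynomial.derivative_C_mul,
    Polynomial.derivative_X]
  ring

theorem hermite_ode (n : ℕ) : Polynomial.derivative (Polynomial.derivative (Polynomial.hermite n)) =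
    Polynomial.X * Polynomial.derivative (Polynomial.hermite n) -
      (n : Polynomial ℤ) * Polynomial.hermite n := by
  have h := derivative_hermite_succ n
  rw [Polynomial.hermite_succ, map_sub, Polynomial.derivative_mul, Polynomial.derivative_X] at h
  linear_combination -h

theorem numberOp_polyGaussian (n : ℕ) : numberOp (polyGaussian (hermitePoly n)) =
    ((n : ℂ) + 1) • polyGaussian (hermitePoly n) := by
  have h2 : (Polynomial.C (Real.sqrt 2)) ^ 2 = Polynomial.C 2 := by
    rw [← map_pow, Real.sq_sqrt (by norm_num)]
  have hode := congrArg (fun p : Polynomial ℤ => (p.map (Int.castRingHom ℝ)).comp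
      (Polynomial.C (Real.sqrt 2) * Polynomial.X)) (hermite_ode n)
  simp only [Polynomial.map_sub, Polynomial.map_mul, Polynomial.map_X, Polynomial.sub_comp,
    Polynomial.mul_comp, Polynomial.X_comp, Polynomial.map_natCast, Polynomial.natCast_comp,
    ← Polynomial.derivative_map] at hode
  have hc : ((n : ℂ) + 1) = (((n : ℝ) + 1 : ℝ) : ℂ) := by push_cast; ring
  have hc2 : (1 / 2 : ℂ) = ((1 / 2 : ℝ) : ℂ) := by push_cast; ring
  rw [numberOp_eq, polyGaussian_D, polyGaussian_D, polyGaussian_X, polyGaussian_X,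
    ← polyGaussian_neg, ← polyGaussian_add, ← polyGaussian_add, hc, hc2, ← polyGaussian_smul,
    ← polyGaussian_smul]
  congr 1
  have h3 : (Polynomial.C (1 / 2 : ℝ)) * Polynomial.C 2 = 1 := by
    rw [← map_mul]; norm_num
  have h4 : Polynomial.C ((n : ℝ) + 1) = (n : Polynomial ℝ) + 1 := by simp
  rw [h4]
  simp only [hermitePoly, Polynomial.derivative_comp,
    Polynomial.derivative_X, Polynomial.derivative_mul, Polynomial.derivative_C, map_sub,
    zero_mul, zero_add, mul_one]
  set H := (Polynomial.hermite n).map (Int.castRingHom ℝ)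
  set Y := Polynomial.C (Real.sqrt 2) * Polynomial.X
  set A := H.comp Y
  set B := (Polynomial.derivative H).comp Y
  set E := (Polynomial.derivative (Polynomial.derivative H)).comp Y
  set c := Polynomial.C (Real.sqrt 2)
  set d := Polynomial.C (1 / 2 : ℝ)
  have h5 : d * c ^ 2 = 1 := by rw [h2]; exact h3
  have h6 : d * 2 = 1 := h3
  simp only [Y] at hode
  linear_combination (-1 : Polynomial ℝ) * hode + (A + c * Polynomial.X * B) * h6 - E * h5

theorem numberOp_hermiteFun (n : ℕ) :
    numberOp (hermiteFun n) = ((n : ℂ) + 1) • hermiteFun n := by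
  change numberOp (_ • polyGaussian (hermitePoly n)) = _ • (_ • polyGaussian (hermitePoly n))
  rw [map_smul, smul_comm, ← numberOp_polyGaussian]

theorem hermiteFun_succ (n : ℕ) : (((Real.sqrt (2 * (n + 1)) : ℝ)) : ℂ) • hermiteFun (n + 1) =
    schwartzX (hermiteFun n) - schwartzD (hermiteFun n) := by
  have h := hermitePoly_succ n
  have e : polyGaussian (Polynomial.C (Real.sqrt 2) * hermitePoly (n + 1)) =
      schwartzX (polyGaussian (hermitePoly n)) - schwartzD (polyGaussian (hermitePoly n)) := by
    rw [h, polyGaussian_D, polyGaussian_X, sub_eq_add_neg (polyGaussian _), ← polyGaussian_neg,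
      ← polyGaussian_add]
    congr 1
    have : (Polynomial.C (2 : ℝ)) = 2 := rfl
    rw [this]; ring
  change _ • (_ • polyGaussian (hermitePoly (n + 1))) =
    schwartzX (_ • polyGaussian (hermitePoly n)) - schwartzD (_ • polyGaussian (hermitePoly n))
  rw [map_smul, map_smul, ← smul_sub, ← e, polyGaussian_smul, smul_smul, smul_smul]
  congr 1
  rw [← Complex.ofReal_mul, ← Complex.ofReal_mul]
  congr 1
  rw [Nat.factorial_succ, Nat.cast_mul, Real.sqrt_mul (by norm_num) ((n : ℝ) + 1),
    show Real.sqrt Real.pi * (((n + 1 : ℕ) : ℝ) * (n.factorial : ℝ)) =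
      ((n : ℝ) + 1) * (Real.sqrt Real.pi * n.factorial) by push_cast; ring,
    Real.sqrt_mul (by positivity)]
  have h1 : Real.sqrt ((n : ℝ) + 1) ≠ 0 := by positivity
  have h2 : Real.sqrt (Real.sqrt Real.pi * n.factorial) ≠ 0 := by positivity
  field_simp

theorem hNorm_zero_hermiteFun (n : ℕ) : hNorm 0 (hermiteFun n) = hNorm 0 (hermiteFun 0) := by
  induction n with
  | zero => rfl
  | succ n ih =>
    rw [← ih]
    have key (φ : 𝓢(ℝ, ℂ)) : hNorm 0 (schwartzX φ - schwartzD φ) ^ 2 = 2 * ip φ (numberOp φ) := by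
      have hsymm (a b : 𝓢(ℝ, ℂ)) : ip a b = ip b a := inner_re_symm (𝕜 := ℂ) _ _
      have h1 := ip_D φ (schwartzX φ)
      rw [D_X, ip_add_right, ip_X, ip_self, hsymm (schwartzD φ)] at h1
      have h2 (a b : 𝓢(ℝ, ℂ)) : ip (a - b) (a - b) = ip a a - ip a b - ip b a + ip b b := by
        simp only [ip, map_sub, inner_sub_left, inner_sub_right, Complex.sub_re]; ring
      rw [two_ip_numberOp, ← ip_self, h2, hsymm (schwartzD φ), ip_self, ip_self]
      linarith
    have h := key (hermiteFun n)
    rw [← hermiteFun_succ, hNorm_smul, numberOp_hermiteFun] at h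
    have e : ip (hermiteFun n) (((n : ℂ) + 1) • hermiteFun n) = (n + 1) * hNorm 0 (hermiteFun n) ^ 2 := by
      rw [← ip_self]
      simp only [ip, map_smul, inner_smul_right]
      have : ((n : ℂ) + 1) = (((n : ℝ) + 1 : ℝ) : ℂ) := by push_cast; ring
      rw [this, Complex.re_ofReal_mul]
    rw [e, mul_pow, Complex.norm_real, Real.norm_eq_abs, sq_abs, Real.sq_sqrt (by positivity),
      ← mul_assoc] at h
    have h0 : (2 * ((n : ℝ) + 1)) ≠ 0 := by positivity
    have := mul_left_cancel₀ h0 h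
    exact (sq_eq_sq₀ (hNorm_nonneg _ _) (hNorm_nonneg _ _)).1 this

theorem hNorm_hermiteFun (m n : ℕ) :
    hNorm m (hermiteFun n) = ((n : ℝ) + 1) ^ m * hNorm 0 (hermiteFun 0) := by
  induction m with
  | zero => rw [hNorm_zero_hermiteFun]; simp
  | succ m ih =>
    rw [← hNorm_numberOp, numberOp_hermiteFun, hNorm_smul, ih, pow_succ]
    have : ((n : ℂ) + 1) = (((n : ℝ) + 1 : ℝ) : ℂ) := by push_cast; ring
    rw [this, Complex.norm_real, Real.norm_of_nonneg (by positivity)]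
    ring

/-! ### The sequence spaces and the tempered algebra -/

/-- The real sequences in `𝐬`: rapidly decreasing sequences. -/
def rapidSeq : Set (ℕ → ℝ) :=
  {a | ∀ m : ℕ, Summable fun n : ℕ => ((n : ℝ) + 1) ^ (2 * m) * |a n| ^ 2}

/-- The real sequences in `𝐬'`: sequences of at most polynomial growth. -/
def slowSeq : Set (ℕ → ℝ) :=
  {b | ∃ C : ℝ, ∃ m : ℕ, ∀ n : ℕ, |b n| ≤ C * ((n : ℝ) + 1) ^ m}

theorem rapidSeq_mono {a b : ℕ → ℝ} (ha : a ∈ rapidSeq) (C : ℝ) (h : ∀ n, |b n| ≤ C * |a n|) :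
    b ∈ rapidSeq := by
  intro m
  refine Summable.of_nonneg_of_le (fun n => by positivity) (fun n => ?_) ((ha m).mul_left (C ^ 2))
  have h1 : |b n| ^ 2 ≤ (C * |a n|) ^ 2 := pow_le_pow_left₀ (abs_nonneg _) (h n) 2
  calc ((n : ℝ) + 1) ^ (2 * m) * |b n| ^ 2 ≤ ((n : ℝ) + 1) ^ (2 * m) * (C * |a n|) ^ 2 := by gcongr
    _ = _ := by ring

theorem rapidSeq_add {a b : ℕ → ℝ} (ha : a ∈ rapidSeq) (hb : b ∈ rapidSeq) : a + b ∈ rapidSeq := by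
  intro m
  refine Summable.of_nonneg_of_le (fun n => by positivity) (fun n => ?_)
    (((ha m).add (hb m)).mul_left 2)
  have h1 : |(a + b) n| ^ 2 ≤ 2 * (|a n| ^ 2 + |b n| ^ 2) := by
    simp only [sq_abs, Pi.add_apply]; nlinarith [sq_nonneg (a n - b n)]
  calc ((n : ℝ) + 1) ^ (2 * m) * |(a + b) n| ^ 2
      ≤ ((n : ℝ) + 1) ^ (2 * m) * (2 * (|a n| ^ 2 + |b n| ^ 2)) := by gcongr
    _ = _ := by ring

theorem slowSeq_mono {a b : ℕ → ℝ} (ha : a ∈ slowSeq) {K : ℝ} (hK : 0 ≤ K)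
    (h : ∀ n, |b n| ≤ K * |a n|) : b ∈ slowSeq := by
  obtain ⟨C, m, hC⟩ := ha
  refine ⟨K * C, m, fun n => (h n).trans ?_⟩
  rw [mul_assoc]
  exact mul_le_mul_of_nonneg_left (hC n) hK

theorem slowSeq_add {a b : ℕ → ℝ} (ha : a ∈ slowSeq) (hb : b ∈ slowSeq) : a + b ∈ slowSeq := by
  obtain ⟨C, m, hC⟩ := ha
  obtain ⟨C', m', hC'⟩ := hb
  refine ⟨|C| + |C'|, m + m', fun n => ?_⟩
  have h1 : (1 : ℝ) ≤ (n : ℝ) + 1 := by simp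
  have e1 : C * ((n : ℝ) + 1) ^ m ≤ |C| * ((n : ℝ) + 1) ^ (m + m') := by
    gcongr
    · exact le_abs_self C
    · omega
  have e2 : C' * ((n : ℝ) + 1) ^ m' ≤ |C'| * ((n : ℝ) + 1) ^ (m + m') := by
    gcongr
    · exact le_abs_self C'
    · omega
  calc |(a + b) n| ≤ |a n| + |b n| := abs_add_le _ _
    _ ≤ _ := by linarith [hC n, hC' n]

/-- `𝓗_{𝐬'}`: the sequences `(f_n)` of Schwartz functions such that `(‖f_n‖_m) ∈ 𝐬'` for all
`m`. -/
def moderate : Submodule ℂ (ℕ → 𝓢(ℝ, ℂ)) where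
  carrier := {f | ∀ m : ℕ, (fun n => hNorm m (f n)) ∈ slowSeq}
  zero_mem' m := ⟨0, 0, fun n => by simp [hNorm_zero]⟩
  add_mem' {f g} hf hg m := by
    refine slowSeq_mono (slowSeq_add (hf m) (hg m)) zero_le_one fun n => ?_
    rw [abs_of_nonneg (hNorm_nonneg _ _), one_mul]
    exact (hNorm_add_le _ _ _).trans (le_abs_self _)
  smul_mem' c f hf m := by
    refine slowSeq_mono (hf m) (norm_nonneg c) fun n => ?_
    rw [Pi.smul_apply, hNorm_smul, abs_mul, abs_norm]

/-- `𝓗_𝐬`: the sequences `(f_n)` of Schwartz functions such that `(‖f_n‖_m) ∈ 𝐬` for all `m`. -/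
def negligible : Submodule ℂ (ℕ → 𝓢(ℝ, ℂ)) where
  carrier := {f | ∀ m : ℕ, (fun n => hNorm m (f n)) ∈ rapidSeq}
  zero_mem' m k := by simp [hNorm_zero, summable_zero]
  add_mem' {f g} hf hg m := by
    refine rapidSeq_mono (rapidSeq_add (hf m) (hg m)) 1 fun n => ?_
    rw [abs_of_nonneg (hNorm_nonneg _ _), one_mul]
    exact (hNorm_add_le _ _ _).trans (le_abs_self _)
  smul_mem' c f hf m := by
    refine rapidSeq_mono (hf m) ‖c‖ fun n => ?_
    rw [Pi.smul_apply, hNorm_smul, abs_mul, abs_norm]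

/-- The space `𝓗 = 𝓗_{𝐬'} / 𝓗_𝐬` of tempered generalized functions. -/
abbrev TemperedGenFun : Type := ↥moderate ⧸ negligible.submoduleOf moderate

/-- The class `[f_n]` of a sequence `(f_n) ∈ 𝓗_{𝐬'}`. -/
def cls (f : ℕ → 𝓢(ℝ, ℂ)) (hf : f ∈ moderate) : TemperedGenFun :=
  Submodule.Quotient.mk ⟨f, hf⟩

/-- An operator on the Schwartz space that is bounded with respect to the norms `‖·‖_m` preserves
`𝓗_{𝐬'}`. -/
theorem moderate_map {A : 𝓢(ℝ, ℂ) →L[ℂ] 𝓢(ℝ, ℂ)}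
    (hA : ∀ m, ∃ C : ℝ, ∃ M : ℕ, 0 ≤ C ∧ ∀ φ, hNorm m (A φ) ≤ C * hNorm M φ)
    {f : ℕ → 𝓢(ℝ, ℂ)} (hf : f ∈ moderate) : (fun n => A (f n)) ∈ moderate := by
  intro m
  obtain ⟨C, M, hC, h⟩ := hA m
  refine slowSeq_mono (hf M) hC fun n => ?_
  rw [abs_of_nonneg (hNorm_nonneg _ _), abs_of_nonneg (hNorm_nonneg _ _)]
  exact h _

theorem negligible_map {A : 𝓢(ℝ, ℂ) →L[ℂ] 𝓢(ℝ, ℂ)}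
    (hA : ∀ m, ∃ C : ℝ, ∃ M : ℕ, 0 ≤ C ∧ ∀ φ, hNorm m (A φ) ≤ C * hNorm M φ)
    {f : ℕ → 𝓢(ℝ, ℂ)} (hf : f ∈ negligible) : (fun n => A (f n)) ∈ negligible := by
  intro m
  obtain ⟨C, M, hC, h⟩ := hA m
  refine rapidSeq_mono (hf M) C fun n => ?_
  rw [abs_of_nonneg (hNorm_nonneg _ _), abs_of_nonneg (hNorm_nonneg _ _)]
  exact h _

/-- The termwise operator `[f_n] ↦ [A f_n]` on `𝓗`, for an operator `A` on the Schwartz space that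
is bounded with respect to the norms `‖·‖_m`. -/
def termwise (A : 𝓢(ℝ, ℂ) →L[ℂ] 𝓢(ℝ, ℂ))
    (hA : ∀ m, ∃ C : ℝ, ∃ M : ℕ, 0 ≤ C ∧ ∀ φ, hNorm m (A φ) ≤ C * hNorm M φ) :
    TemperedGenFun →ₗ[ℂ] TemperedGenFun :=
  Submodule.mapQ _ _
    { toFun := fun f => (⟨fun n => A (f.1 n), moderate_map hA f.2⟩ : moderate)
      map_add' := fun f g => by ext n; simp
      map_smul' := fun c f => by ext n; simp }
    (fun _ hf => negligible_map hA hf)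

/-- The derivative `D[f_n] = [D f_n]` on `𝓗`. -/
def genD : TemperedGenFun →ₗ[ℂ] TemperedGenFun := termwise schwartzD schwartzD_bound

/-- Multiplication by the variable, `x[f_n] = [x f_n]`, on `𝓗`. -/
def genX : TemperedGenFun →ₗ[ℂ] TemperedGenFun := termwise schwartzX schwartzX_bound

theorem genD_pow_cls (α : ℕ) (f : ℕ → 𝓢(ℝ, ℂ)) (hf : f ∈ moderate) :
    (genD ^ α) (cls f hf) =
      cls (fun n => (schwartzD ^ α) (f n)) (moderate_map (pow_le _ schwartzD_bound α) hf) := by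
  induction α with
  | zero => rfl
  | succ α ih => rw [pow_succ', Module.End.mul_apply, ih]; simp only [pow_succ' schwartzD]; rfl

theorem genX_pow_cls (α : ℕ) (f : ℕ → 𝓢(ℝ, ℂ)) (hf : f ∈ moderate) :
    (genX ^ α) (cls f hf) =
      cls (fun n => (schwartzX ^ α) (f n)) (moderate_map (pow_le _ schwartzX_bound α) hf) := by
  induction α with
  | zero => rfl
  | succ α ih => rw [pow_succ', Module.End.mul_apply, ih]; simp only [pow_succ' schwartzX]; rfl

/-! ### The embedding of the tempered distributions -/

/-- The partial sums `T_n = ∑_{j=0}^n T(h_j) h_j` of the Hermite expansion of `T`. -/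
def hermiteSum (T : 𝓢'(ℝ, ℂ)) (n : ℕ) : 𝓢(ℝ, ℂ) :=
  ∑ j ∈ Finset.range (n + 1), T (hermiteFun j) • hermiteFun j

theorem hermiteSum_mem (T : 𝓢'(ℝ, ℂ)) : hermiteSum T ∈ moderate := by
  intro m
  obtain ⟨C, M, hC, h⟩ := tempered_bound T
  have h0 := hNorm_nonneg 0 (hermiteFun 0)
  set K := hNorm 0 (hermiteFun 0)
  refine ⟨C * K * K, M + m + 1, fun n => ?_⟩
  rw [abs_of_nonneg (hNorm_nonneg _ _)]
  have hsum (s : Finset ℕ) (g : ℕ → 𝓢(ℝ, ℂ)) : hNorm m (∑ j ∈ s, g j) ≤ ∑ j ∈ s, hNorm m (g j) :=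
    Finset.le_sum_of_subadditive _ (hNorm_zero m).le (hNorm_add_le m) s g
  have hterm (j : ℕ) (hj : j ∈ Finset.range (n + 1)) :
      hNorm m (T (hermiteFun j) • hermiteFun j) ≤ C * K * K * ((n : ℝ) + 1) ^ (M + m) := by
    have hj' : (j : ℝ) + 1 ≤ (n : ℝ) + 1 := by
      have : j ≤ n := by simpa [Nat.lt_succ_iff] using hj
      gcongr
    have h1 := h (hermiteFun j)
    rw [hNorm_hermiteFun] at h1
    rw [hNorm_smul, hNorm_hermiteFun]
    calc ‖T (hermiteFun j)‖ * (((j : ℝ) + 1) ^ m * K)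
        ≤ (C * (((j : ℝ) + 1) ^ M * K)) * (((j : ℝ) + 1) ^ m * K) := by gcongr
      _ ≤ (C * (((n : ℝ) + 1) ^ M * K)) * (((n : ℝ) + 1) ^ m * K) := by gcongr
      _ = _ := by ring
  refine (hsum _ _).trans ((Finset.sum_le_sum hterm).trans (le_of_eq ?_))
  simp
  ring

/-- The embedding `ι(T) = [T_n]` of the tempered distributions into `𝓗`. -/
def embed : 𝓢'(ℝ, ℂ) →ₗ[ℂ] TemperedGenFun where
  toFun T := cls (hermiteSum T) (hermiteSum_mem T)
  map_add' S T := by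
    have : (⟨hermiteSum (S + T), hermiteSum_mem (S + T)⟩ : moderate) =
        ⟨hermiteSum S, hermiteSum_mem S⟩ + ⟨hermiteSum T, hermiteSum_mem T⟩ := by
      ext1; funext n
      change hermiteSum (S + T) n = hermiteSum S n + hermiteSum T n
      simp only [hermiteSum, ← Finset.sum_add_distrib, ← add_smul]; rfl
    exact congrArg Submodule.Quotient.mk this
  map_smul' c T := by
    have : (⟨hermiteSum (c • T), hermiteSum_mem (c • T)⟩ : moderate) =
        c • ⟨hermiteSum T, hermiteSum_mem T⟩ := by
      ext1; funext n
      change hermiteSum (c • T) n = c • hermiteSum T n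
      simp only [hermiteSum, Finset.smul_sum, smul_smul]; rfl
    exact congrArg Submodule.Quotient.mk this

/-! ### The Fourier transform on Schwartz functions and tempered distributions -/

/-- The dilation `φ ↦ φ(c ·)`, for `c ≠ 0`. -/
def dilate (c : ℝ) (hc : c ≠ 0) : 𝓢(ℝ, ℂ) →L[ℂ] 𝓢(ℝ, ℂ) :=
  SchwartzMap.compCLMOfContinuousLinearEquiv ℂ
    (ContinuousLinearEquiv.unitsEquivAut ℝ (Units.mk0 c hc))

theorem dilate_apply (c : ℝ) (hc : c ≠ 0) (φ : 𝓢(ℝ, ℂ)) (x : ℝ) :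
    dilate c hc φ x = φ (x * c) := rfl

theorem two_pi_ne_zero : 2 * Real.pi ≠ 0 := by positivity

/-- The Fourier transform `𝓕 φ(t) = (2π)^{-1/2} ∫ e^{-itx} φ(x) dx` as a topological automorphism
of the Schwartz space, obtained from Mathlib's `∫ e^{-2πitx} φ(x) dx` by rescaling; the integral
formulas are `schwartzFourier_apply` and `schwartzFourier_symm_apply`. -/
def schwartzFourier : 𝓢(ℝ, ℂ) ≃L[ℂ] 𝓢(ℝ, ℂ) :=
  ContinuousLinearEquiv.equivOfInverse
    ((((Real.sqrt (2 * Real.pi))⁻¹ : ℝ) : ℂ) •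
      (dilate (2 * Real.pi)⁻¹ (inv_ne_zero two_pi_ne_zero) ∘L
        FourierTransform.fourierCLM ℂ 𝓢(ℝ, ℂ)))
    (((Real.sqrt (2 * Real.pi) : ℝ) : ℂ) •
      (FourierTransform.fourierInvCLM ℂ 𝓢(ℝ, ℂ) ∘L dilate (2 * Real.pi) two_pi_ne_zero))
    (fun φ => by
      have h : dilate (2 * Real.pi) two_pi_ne_zero
          (dilate (2 * Real.pi)⁻¹ (inv_ne_zero two_pi_ne_zero) (𝓕 φ)) = 𝓕 φ := by
        ext x
        simp only [dilate_apply]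
        rw [mul_assoc, mul_inv_cancel₀ two_pi_ne_zero, mul_one]
      have h2 : ((Real.sqrt (2 * Real.pi) : ℝ) : ℂ) * (((Real.sqrt (2 * Real.pi))⁻¹ : ℝ) : ℂ) = 1 := by
        rw [← Complex.ofReal_mul, mul_inv_cancel₀ (by positivity), Complex.ofReal_one]
      simp only [smul_apply, ContinuousLinearMap.comp_apply, map_smul,
        FourierTransform.fourierCLM_apply, FourierTransform.fourierInvCLM_apply, h,
        FourierTransform.fourierInv_fourier_eq]
      rw [smul_smul, mul_comm, h2, one_smul])
    (fun φ => by
      have h : dilate (2 * Real.pi)⁻¹ (inv_ne_zero two_pi_ne_zero)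
          (dilate (2 * Real.pi) two_pi_ne_zero φ) = φ := by
        ext x
        simp only [dilate_apply]
        rw [mul_assoc, inv_mul_cancel₀ two_pi_ne_zero, mul_one]
      have h2 : (((Real.sqrt (2 * Real.pi))⁻¹ : ℝ) : ℂ) * ((Real.sqrt (2 * Real.pi) : ℝ) : ℂ) = 1 := by
        rw [← Complex.ofReal_mul, inv_mul_cancel₀ (by positivity), Complex.ofReal_one]
      simp only [smul_apply, ContinuousLinearMap.comp_apply, map_smul,
        FourierTransform.fourierCLM_apply, FourierTransform.fourierInvCLM_apply,
        FourierTransform.fourier_fourierInv_eq, h]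
      rw [smul_smul, mul_comm, h2, one_smul])

theorem schwartzFourier_apply (φ : 𝓢(ℝ, ℂ)) (t : ℝ) : schwartzFourier φ t =
    (1 / Real.sqrt (2 * Real.pi) : ℝ) *
      ∫ x : ℝ, Complex.exp (-(Complex.I * t * x)) * φ x := by
  change (((Real.sqrt (2 * Real.pi))⁻¹ : ℝ) : ℂ) * (𝓕 φ : 𝓢(ℝ, ℂ)) (t * (2 * Real.pi)⁻¹) = _
  rw [SchwartzMap.fourier_coe, Real.fourier_eq', one_div]
  congr 2
  ext x
  rw [smul_eq_mul]
  congr 2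
  simp
  field_simp

theorem schwartzFourier_symm_apply (φ : 𝓢(ℝ, ℂ)) (x : ℝ) : schwartzFourier.symm φ x =
    (1 / Real.sqrt (2 * Real.pi) : ℝ) *
      ∫ t : ℝ, Complex.exp (Complex.I * t * x) * φ t := by
  change ((Real.sqrt (2 * Real.pi) : ℝ) : ℂ) *
    (𝓕⁻ (dilate (2 * Real.pi) two_pi_ne_zero φ) : 𝓢(ℝ, ℂ)) x = _
  rw [SchwartzMap.fourierInv_coe, Real.fourierInv_eq']
  have h := MeasureTheory.Measure.integral_comp_mul_right
    (fun t : ℝ => Complex.exp (Complex.I * t * x) * φ t) (2 * Real.pi)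
  have e : (∫ v : ℝ, Complex.exp (((2 * Real.pi * inner ℝ v x : ℝ) : ℂ) * Complex.I) •
      dilate (2 * Real.pi) two_pi_ne_zero φ v) =
      ∫ v : ℝ, Complex.exp (Complex.I * ((v * (2 * Real.pi) : ℝ) : ℂ) * x) *
        φ (v * (2 * Real.pi)) := by
    congr 1
    ext v
    rw [smul_eq_mul, dilate_apply]
    congr 2
    simp
    ring
  rw [e, h, abs_of_pos (by positivity), Complex.real_smul, ← mul_assoc, ← Complex.ofReal_mul]
  congr 2
  have h1 : Real.sqrt (2 * Real.pi) ≠ 0 := by positivity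
  have h2 : Real.sqrt (2 * Real.pi) ^ 2 = 2 * Real.pi := Real.sq_sqrt (by positivity)
  have h3 : (2 * Real.pi)⁻¹ = (Real.sqrt (2 * Real.pi) ^ 2)⁻¹ := by rw [h2]
  rw [h3]
  field_simp

/-- The Fourier transform of tempered distributions, `(𝓕 T)(φ) = T(𝓕 φ)`. -/
def distFourier (T : 𝓢'(ℝ, ℂ)) : 𝓢'(ℝ, ℂ) :=
  PointwiseConvergenceCLM.precomp ℂ (schwartzFourier : 𝓢(ℝ, ℂ) →L[ℂ] 𝓢(ℝ, ℂ)) T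

theorem distFourier_apply (T : 𝓢'(ℝ, ℂ)) (φ : 𝓢(ℝ, ℂ)) :
    distFourier T φ = T (schwartzFourier φ) := rfl

end TemperedGF

end

namespace TemperedGF

/-! On Schwartz functions the unitary Fourier transform intertwines the position and momentum
operators: `𝓕 D = i x 𝓕` and `𝓕 x = i D 𝓕`. Hence `𝓕(-D²) = x² 𝓕` and `𝓕 x² = -D² 𝓕`, so the
harmonic oscillator `N + 1` commutes with `𝓕`. With Plancherel this makes `𝓕` an isometry for every
norm `‖·‖_m` (`hNorm_schwartzFourier`), and the same holds for its inverse. Both therefore preserve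
`𝓗_{𝐬'}` and `𝓗_𝐬` and descend to mutually inverse maps of the quotient. The exchange rules on `𝓗`
are the rules on `𝓢` read termwise, followed by induction on the exponent.

For distributions the point is that the Hermite functions are eigenvectors: `𝓕 h_n = (-i)^n h_n`
(`schwartzFourier_hermiteFun`). The Gaussian `h_0` is fixed, and the creation operator `x - D`
satisfies `𝓕(x - D) = -i (x - D) 𝓕`. Thus `𝓕` acts diagonally on Hermite expansions and the
eigenvalue can be moved from `h_j` into the coefficient, so that `𝓕(T_n) = (𝓕T)_n` for each `n`. All
identities in `𝓗` thus hold already between representatives, index by index; negligible sequences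
enter only in the well-definedness. -/

/-! ### Commutation of the Fourier transform with `D`, `x` and `N + 1` -/

/-- Reduces the unitary normalization to the kernel `e^{-2πitx}`, whose calculus rules then apply at
the rescaled point `t / 2π`. -/
theorem schwartzFourier_eq_fourier (φ : 𝓢(ℝ, ℂ)) (t : ℝ) : schwartzFourier φ t =
    (((Real.sqrt (2 * Real.pi))⁻¹ : ℝ) : ℂ) * 𝓕 (φ : ℝ → ℂ) (t * (2 * Real.pi)⁻¹) := rfl

/-- For the kernel `e^{-2πitx}` differentiation becomes multiplication by `2πi w`; at `w = t / 2π`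
this factor is `i t`. -/
theorem schwartzFourier_D (φ : 𝓢(ℝ, ℂ)) :
    schwartzFourier (schwartzD φ) = Complex.I • schwartzX (schwartzFourier φ) := by
  ext t
  have h := congrFun (Real.fourier_deriv (f := (φ : ℝ → ℂ)) φ.integrable φ.differentiable
    (schwartzD φ).integrable) (t * (2 * Real.pi)⁻¹)
  have e : (schwartzD φ : ℝ → ℂ) = deriv φ := rfl
  rw [smul_apply, schwartzX_apply, schwartzFourier_eq_fourier, schwartzFourier_eq_fourier, e, h]
  have hpi : (Real.pi : ℂ) ≠ 0 := Complex.ofReal_ne_zero.2 Real.pi_ne_zero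
  simp only [smul_eq_mul]
  push_cast
  field_simp

theorem schwartzFourier_X (φ : 𝓢(ℝ, ℂ)) :
    schwartzFourier (schwartzX φ) = Complex.I • schwartzD (schwartzFourier φ) := by
  ext t
  have e : (fun x : ℝ => x • (φ : ℝ → ℂ) x) = schwartzX φ := by
    ext x; rw [schwartzX_apply, Complex.real_smul]
  have h := Real.hasDerivAt_fourier (f := (φ : ℝ → ℂ)) φ.integrable
    (by rw [e]; exact (schwartzX φ).integrable) (t * (2 * Real.pi)⁻¹)
  -- Chain rule: the inner derivative `(2π)⁻¹` cancels the `2π` in the factor `-2πi x` produced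
  -- under the integral, giving `D 𝓕φ = -i 𝓕(xφ)`.
  have h2 := (h.scomp t ((hasDerivAt_id t).mul_const (2 * Real.pi)⁻¹)).const_mul
    ((((Real.sqrt (2 * Real.pi))⁻¹ : ℝ) : ℂ))
  have e2 : (fun x : ℝ => (-2 * Real.pi * Complex.I * x) • (φ : ℝ → ℂ) x) =
      (-2 * Real.pi * Complex.I) • (schwartzX φ : ℝ → ℂ) := by
    ext x; simp [schwartzX_apply, mul_assoc]
  have e3 : 𝓕 ((-2 * Real.pi * Complex.I) • (schwartzX φ : ℝ → ℂ)) =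
      (-2 * Real.pi * Complex.I) • 𝓕 (schwartzX φ : ℝ → ℂ) := by
    ext w
    simp only [Real.fourier_eq, Pi.smul_apply]
    rw [← MeasureTheory.integral_smul]
    exact MeasureTheory.integral_congr_ae (.of_forall fun v => smul_comm _ _ _)
  rw [e2, e3] at h2
  have h3 : schwartzD (schwartzFourier φ) t = _ := h2.deriv
  have hpi : (Real.pi : ℂ) ≠ 0 := Complex.ofReal_ne_zero.2 Real.pi_ne_zero
  rw [smul_apply, h3, schwartzFourier_eq_fourier]
  simp only [smul_eq_mul, Pi.smul_apply, Complex.real_smul]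
  push_cast
  field_simp
  simp

/-- `-D²` and `x²` are exchanged, since each double application produces `i² = -1`; their sum is
invariant. -/
theorem schwartzFourier_numberOp (φ : 𝓢(ℝ, ℂ)) :
    schwartzFourier (numberOp φ) = numberOp (schwartzFourier φ) := by
  simp only [numberOp_eq, map_smul, map_add, map_neg, schwartzFourier_D, schwartzFourier_X,
    smul_smul, Complex.I_mul_I]
  module

/-! ### Isometry for the norms `‖·‖_m` -/

/-- Plancherel for `m = 0`; commutation with `N + 1` raises `m`. -/
theorem hNorm_schwartzFourier (m : ℕ) (φ : 𝓢(ℝ, ℂ)) :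
    hNorm m (schwartzFourier φ) = hNorm m φ := by
  induction m generalizing φ with
  | zero =>
    -- The substitution has Jacobian `2π`, which cancels the square of the prefactor `(2π)^{-1/2}`.
    have h := MeasureTheory.Measure.integral_comp_mul_right
      (fun t : ℝ => ‖(𝓕 φ : 𝓢(ℝ, ℂ)) t‖ ^ 2) (2 * Real.pi)⁻¹
    rw [SchwartzMap.integral_norm_sq_fourier, inv_inv, abs_of_pos (by positivity)] at h
    have e (t : ℝ) : ‖schwartzFourier φ t‖ ^ 2 =
        (2 * Real.pi)⁻¹ * ‖(𝓕 φ : 𝓢(ℝ, ℂ)) (t * (2 * Real.pi)⁻¹)‖ ^ 2 := by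
      rw [schwartzFourier_eq_fourier, norm_mul, mul_pow, Complex.norm_real, Real.norm_eq_abs,
        sq_abs, inv_pow, Real.sq_sqrt (by positivity)]
      rfl
    simp only [hNorm, pow_zero, one_apply_eq_self]
    simp only [e]
    rw [MeasureTheory.integral_const_mul, h, smul_eq_mul, inv_mul_cancel_left₀ two_pi_ne_zero]
  | succ m ih => rw [← hNorm_numberOp, ← hNorm_numberOp, ← schwartzFourier_numberOp, ih]

/-! ### Hermite functions as eigenvectors -/

theorem schwartzFourier_hermiteFun_zero : schwartzFourier (hermiteFun 0) = hermiteFun 0 := by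
  ext t
  -- The Gaussian integral is stated with kernel `e^{itx}`, hence the argument `-t`; `b = 1/2` is
  -- the self-dual width.
  have h := fourierIntegral_gaussian (b := 1 / 2) (by norm_num) (-t)
  have hc : (Real.pi / (1 / 2 : ℂ)) ^ (1 / 2 : ℂ) = ((Real.sqrt (2 * Real.pi) : ℝ) : ℂ) := by
    rw [Real.sqrt_eq_rpow, Complex.ofReal_cpow (by positivity)]
    push_cast
    congr 1
    ring
  have e : (fun x : ℝ => Complex.exp (-(Complex.I * t * x)) * hermiteFun 0 x) = fun x : ℝ =>
      (((Real.sqrt (Real.sqrt Real.pi))⁻¹ : ℝ) : ℂ) *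
        (Complex.exp (Complex.I * -t * x) * Complex.exp (-(1 / 2) * (x : ℂ) ^ 2)) := by
    ext x
    rw [hermiteFun_apply]
    simp only [Nat.factorial_zero, Nat.cast_one, mul_one, Polynomial.hermite_zero, map_one]
    push_cast
    rw [show Complex.I * -t * x = -(Complex.I * t * x) by ring,
      show -(1 / 2) * (x : ℂ) ^ 2 = -(x : ℂ) ^ 2 / 2 by ring]
    ring
  rw [schwartzFourier_apply, e, MeasureTheory.integral_const_mul, h, hc, hermiteFun_apply]
  have h1 : ((Real.sqrt (2 * Real.pi) : ℝ) : ℂ) ≠ 0 :=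
    Complex.ofReal_ne_zero.2 (by positivity)
  simp only [Nat.factorial_zero, Nat.cast_one, mul_one, Polynomial.hermite_zero, map_one]
  rw [show -(-(t : ℂ)) ^ 2 / (4 * (1 / 2)) = -(t : ℂ) ^ 2 / 2 by ring]
  push_cast
  field_simp

theorem schwartzFourier_hermiteFun (n : ℕ) :
    schwartzFourier (hermiteFun n) = (-Complex.I) ^ n • hermiteFun n := by
  induction n with
  | zero => rw [schwartzFourier_hermiteFun_zero, pow_zero, one_smul]
  | succ n ih =>
    have hc : ((Real.sqrt (2 * (n + 1)) : ℝ) : ℂ) ≠ 0 :=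
      Complex.ofReal_ne_zero.2 (by positivity)
    -- Scaling by `√(2(n+1))` turns `h_{n+1}` into `(x - D) h_n`; commuting `𝓕` past `x - D`
    -- contributes one more factor `-i`.
    refine smul_right_injective _ hc ?_
    change ((Real.sqrt (2 * (n + 1)) : ℝ) : ℂ) • schwartzFourier (hermiteFun (n + 1)) =
      ((Real.sqrt (2 * (n + 1)) : ℝ) : ℂ) • (-Complex.I) ^ (n + 1) • hermiteFun (n + 1)
    rw [← map_smul, smul_comm _ ((-Complex.I) ^ (n + 1)), hermiteFun_succ, map_sub,
      schwartzFourier_X, schwartzFourier_D, ih, map_smul, map_smul, pow_succ]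
    module

/-- `T(h_j) 𝓕h_j = T(h_j) (-i)^j h_j = T(𝓕h_j) h_j`, by linearity of `T`. -/
theorem schwartzFourier_hermiteSum (T : 𝓢'(ℝ, ℂ)) (n : ℕ) :
    schwartzFourier (hermiteSum T n) = hermiteSum (distFourier T) n := by
  simp only [hermiteSum, map_sum, map_smul, distFourier_apply, schwartzFourier_hermiteFun,
    smul_smul, smul_eq_mul]
  exact Finset.sum_congr rfl fun j _ => by rw [mul_comm]

/-! ### Passage to the quotient `𝓗` -/

theorem schwartzFourier_bound (m : ℕ) : ∃ C : ℝ, ∃ M : ℕ, 0 ≤ C ∧ ∀ φ,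
    hNorm m ((schwartzFourier : 𝓢(ℝ, ℂ) →L[ℂ] 𝓢(ℝ, ℂ)) φ) ≤ C * hNorm M φ :=
  ⟨1, m, zero_le_one, fun φ => by simp [hNorm_schwartzFourier]⟩

theorem schwartzFourier_symm_bound (m : ℕ) : ∃ C : ℝ, ∃ M : ℕ, 0 ≤ C ∧ ∀ φ,
    hNorm m ((schwartzFourier.symm : 𝓢(ℝ, ℂ) →L[ℂ] 𝓢(ℝ, ℂ)) φ) ≤ C * hNorm M φ :=
  ⟨1, m, zero_le_one, fun φ => by
    -- The isometry is applied to `𝓕⁻¹φ`, so the inverse needs no separate computation.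
    rw [one_mul, ← hNorm_schwartzFourier m (_ : 𝓢(ℝ, ℂ))]; simp⟩

/-- Transfers an identity on `𝓢` to `𝓗` termwise; no negligible correction is ever needed. -/
theorem cls_congr {f g : ℕ → 𝓢(ℝ, ℂ)} (hf : f ∈ moderate) (hg : g ∈ moderate)
    (h : ∀ n, f n = g n) : cls f hf = cls g hg := by
  obtain rfl : f = g := funext h
  rfl

theorem exists_cls (u : TemperedGenFun) : ∃ f, ∃ hf : f ∈ moderate, cls f hf = u := by
  obtain ⟨⟨f, hf⟩, rfl⟩ := Submodule.Quotient.mk_surjective _ u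
  exact ⟨f, hf, rfl⟩

/-- The termwise Fourier transform on `𝓗`. -/
noncomputable def genFourier : TemperedGenFun ≃ₗ[ℂ] TemperedGenFun :=
  LinearEquiv.ofLinearMap (termwise _ schwartzFourier_bound) (termwise _ schwartzFourier_symm_bound)
    (LinearMap.ext fun u => by
      obtain ⟨f, hf, rfl⟩ := exists_cls u
      exact cls_congr _ _ fun n => schwartzFourier.apply_symm_apply (f n))
    (LinearMap.ext fun u => by
      obtain ⟨f, hf, rfl⟩ := exists_cls u
      exact cls_congr _ _ fun n => schwartzFourier.symm_apply_apply (f n))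

theorem genFourier_cls (f : ℕ → 𝓢(ℝ, ℂ)) (hf : f ∈ moderate) :
    genFourier (cls f hf) =
      cls (fun n => schwartzFourier (f n)) (moderate_map schwartzFourier_bound hf) := rfl

theorem genFourier_genD (u : TemperedGenFun) :
    genFourier (genD u) = Complex.I • genX (genFourier u) := by
  obtain ⟨f, hf, rfl⟩ := exists_cls u
  -- The moderateness proof is spelled out so that the scalar multiple of a class on the right is,
  -- by definition, the class of the termwise multiple.
  exact cls_congr _ (moderate.smul_mem Complex.I (moderate_map schwartzX_bound
    (moderate_map schwartzFourier_bound hf))) fun n => schwartzFourier_D (f n)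

theorem genFourier_genX (u : TemperedGenFun) :
    genFourier (genX u) = Complex.I • genD (genFourier u) := by
  obtain ⟨f, hf, rfl⟩ := exists_cls u
  exact cls_congr _ (moderate.smul_mem Complex.I (moderate_map schwartzD_bound
    (moderate_map schwartzFourier_bound hf))) fun n => schwartzFourier_X (f n)

/-- The scalar stays inside the operator `i x`, matching the form `(ix)^α`. -/
theorem genFourier_genD_pow (u : TemperedGenFun) (α : ℕ) :
    genFourier ((genD ^ α) u) = ((Complex.I • genX) ^ α) (genFourier u) := by
  induction α with
  | zero => rfl
  | succ α ih =>
    rw [pow_succ', pow_succ', Module.End.mul_apply, Module.End.mul_apply, genFourier_genD, ih,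
      LinearMap.smul_apply]

theorem genFourier_genX_pow (u : TemperedGenFun) (α : ℕ) :
    genFourier ((genX ^ α) u) = Complex.I ^ α • (genD ^ α) (genFourier u) := by
  induction α with
  | zero => rw [pow_zero, pow_zero, pow_zero, one_smul]; rfl
  | succ α ih =>
    -- Linearity of `D` moves the accumulated scalar `i^α` outside.
    rw [pow_succ', pow_succ' genD, Module.End.mul_apply, Module.End.mul_apply, genFourier_genX, ih,
      map_smul, smul_smul, pow_succ']

end TemperedGF

/-- Well-definedness is expressed by `Φ` living on the quotient while its formula holds for every
moderate representative. -/
theorem mainTheorem3 :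
    ∃ Φ : TemperedGF.TemperedGenFun ≃ₗ[ℂ] TemperedGF.TemperedGenFun,
      -- the termwise Fourier transform is well defined on `𝓗`, and `Φ` is this transform
      (∀ (f : ℕ → 𝓢(ℝ, ℂ)) (hf : f ∈ TemperedGF.moderate),
        ∃ hF : (fun n => TemperedGF.schwartzFourier (f n)) ∈ TemperedGF.moderate,
          Φ (TemperedGF.cls f hf) =
            TemperedGF.cls (fun n => TemperedGF.schwartzFourier (f n)) hF) ∧
      -- its inverse is the termwise inverse Fourier transform
      (∀ (f : ℕ → 𝓢(ℝ, ℂ)) (hf : f ∈ TemperedGF.moderate),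
        ∃ hF : (fun n => TemperedGF.schwartzFourier.symm (f n)) ∈ TemperedGF.moderate,
          Φ.symm (TemperedGF.cls f hf) =
            TemperedGF.cls (fun n => TemperedGF.schwartzFourier.symm (f n)) hF) ∧
      -- exchange of differentiation and multiplication by the variable
      (∀ (u : TemperedGF.TemperedGenFun) (α : ℕ),
        Φ ((TemperedGF.genD ^ α) u) = ((Complex.I • TemperedGF.genX) ^ α) (Φ u)) ∧
      (∀ (u : TemperedGF.TemperedGenFun) (α : ℕ),
        Φ ((TemperedGF.genX ^ α) u) = Complex.I ^ α • (TemperedGF.genD ^ α) (Φ u)) ∧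
      -- compatibility with the embedding of the tempered distributions
      (∀ T : 𝓢'(ℝ, ℂ),
        TemperedGF.embed (TemperedGF.distFourier T) = Φ (TemperedGF.embed T)) := by
  exact ⟨TemperedGF.genFourier,
    fun f hf => ⟨_, TemperedGF.genFourier_cls f hf⟩,
    fun f hf => ⟨TemperedGF.moderate_map TemperedGF.schwartzFourier_symm_bound hf, rfl⟩,
    TemperedGF.genFourier_genD_pow, TemperedGF.genFourier_genX_pow,
    fun T => TemperedGF.cls_congr _ _ fun n => (TemperedGF.schwartzFourier_hermiteSum T n).symm⟩
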